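/- Let $n$ and $i$ be positive integers such that $\gcd(2i,n)=\gcd(i,n)<n$, and put $d=\gcd(i,n)$ (thus the condition says that $n/d>1$ is odd). Let $\mathrm{Tr}(x)=\sum_{k=0}^{n-1}x^{2^k}$ denote the absolute trace $\mathbb{F}_{2^n}\to\mathbb{F}_2$, let $\alpha\in\mathbb{F}_{2^n}$ satisfy $\mathrm{Tr}(\alpha+1)=0$, and define $G_\alpha:\mathbb{F}_{2^n}\to\mathbb{F}_{2^n}$ by $$G_\alpha(x)=\left(x+\mathrm{Tr}(\alpha x+x^{2^i+1})\right)^{2^i+1}.$$ Then $G_\alpha$ is a permutation of $\mathbb{F}_{2^n}$, and for every $c\in\mathbb{F}_{2^d}\setminus\mathbb{F}_2$ it is almost perfect $c$-nonlinear (APcN), that is, $$\max_{a,b\in\mathbb{F}_{2^n}}\#\{x\in\mathbb{F}_{2^n}: G_\alpha(x+a)+c\,G_\alpha(x)=b\}=2.$$ (In the general definition of APcN the maximum is restricted to $a\neq 0$ when $c=1$; here $c\neq 1$.) -/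

import Mathlib

/-- The c-derivative of f in direction a: x ↦ f(x + a) + c f(x)
(in characteristic 2, where plus and minus agree). -/
def cDerivative {F : Type*} [Field F] (f : F → F) (c a x : F) : F :=
  f (x + a) + c * f x

/-- The number of solutions x of f(x + a) + c f(x) = b. -/
noncomputable def cDiffCount {F : Type*} [Field F] (f : F → F) (c a b : F) : ℕ :=
  Set.ncard {x : F | cDerivative f c a x = b}

open Classical in
/-- The c-differential uniformity of f: the maximum of `cDiffCount f c a b` over all a, b,
where a ≠ 0 is required if c = 1. -/
noncomputable def cDiffUniformity {F : Type*} [Field F] [Fintype F] (f : F → F) (c : F) : ℕ :=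
  ((Finset.univ : Finset (F × F)).filter fun p => c = 1 → p.1 ≠ 0).sup
    fun p => cDiffCount f c p.1 p.2

/-- f is almost perfect c-nonlinear: its c-differential uniformity is exactly 2. -/
def IsAPcN {F : Type*} [Field F] [Fintype F] (f : F → F) (c : F) : Prop :=
  cDiffUniformity f c = 2

/-- G(x) = (x + Tr(α x + x^(2^i + 1)))^(2^i + 1), where Tr is the absolute trace, viewed
as an element of F. -/
noncomputable def Galpha {F : Type*} [Field F] [Algebra (ZMod 2) F] (i : ℕ) (α x : F) : F :=
  (x + algebraMap (ZMod 2) F (Algebra.trace (ZMod 2) F (α * x + x ^ (2 ^ i + 1)))) ^ (2 ^ i + 1)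

/-! Write σ x = x^(2^i), h x = x * σ x, Q = `traceQuad` and T = `traceShift`, so that G = h ∘ T.
Since n/d is odd, σ² and σ have the same fixed field K, which makes h injective. Q is invariant
under translation by 1, so T is an involution, and G is a permutation.

Put t = Q(x) + Q(x + a) ∈ 𝔽₂. The c-derivative of G at x is that of h at T x in direction a + t;
completing the square turns it into (1 + c) h(T x + (a + t)/(1 + c)) plus a constant depending only
on a, c and t. Hence each t gives at most one solution, and there are at most two in all.

For both bits to occur with the same value one needs δ (h u + h v) = σ a + a + 1, where δ = (1 +
c)²/c, with u and v separated by a linear form (`exists_separated_solutions`). With u = z s and v =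
z (s + 1), Hilbert 90 reduces this to three trace conditions on m = σ a + a + 1
(`exists_trace_conditions`). Nondegeneracy of the trace form solves them if z * σ z * σ² z ∉ K;
otherwise z is rescaled by K and a cubic over K must attain trace one (`exists_trace_cubic_eq_one`).
-/

/-! ### Trace form and additive Hilbert 90 -/

section Trace

variable {K F : Type*} [Field K] [Field F] [Finite F] [Algebra K F]

/-- The prescribed values extend to a linear functional on F, which the nondegenerate trace form
represents by some m. -/
theorem exists_trace_mul_eq {ι : Type*} {e : ι → F} (he : LinearIndependent K e) (v : ι → K) :
    ∃ m : F, ∀ j, Algebra.trace K F (m * e j) = v j := by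
  have := Module.Finite.of_finite (R := K) (M := F)
  have : Finite K := Finite.of_injective _ (algebraMap K F).injective
  obtain ⟨g, hg⟩ := LinearMap.exists_extend (Module.Basis.constr (Module.Basis.span he) K v)
  refine ⟨((Algebra.traceForm K F).toDual (traceForm_nondegenerate K F)).symm g, fun j => ?_⟩
  rw [← Algebra.traceForm_apply, LinearMap.BilinForm.apply_toDual_symm_apply]
  have h := LinearMap.congr_fun hg (Module.Basis.span he j)
  rw [Module.Basis.constr_basis] at h
  rw [← h, LinearMap.comp_apply, Submodule.subtype_apply, Module.Basis.span_apply]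

theorem eq_zero_of_forall_trace_mul_eq_zero {x : F}
    (h : ∀ y, Algebra.trace K F (x * y) = 0) : x = 0 := by
  have := Module.Finite.of_finite (R := K) (M := F)
  have : Finite K := Finite.of_injective _ (algebraMap K F).injective
  exact (traceForm_nondegenerate K F).1 x h

/-- The additive form of Hilbert's theorem 90 for an automorphism with fixed field `K`. -/
theorem exists_sub_eq_of_trace_eq_zero (σ : F ≃ₐ[K] F)
    (hσ : ∀ x, σ x = x → ∃ k, algebraMap K F k = x) {y : F} (hy : Algebra.trace K F y = 0) :
    ∃ a, σ a - a = y := by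
  have := Module.Finite.of_finite (R := K) (M := F)
  have : Finite K := Finite.of_injective _ (algebraMap K F).injective
  let D : F →ₗ[K] F := σ.toLinearMap - LinearMap.id
  have hD : ∀ x, D x = σ x - x := fun x => rfl
  have hle : D.range ≤ (Algebra.trace K F).ker := by
    rintro _ ⟨x, rfl⟩
    rw [LinearMap.mem_ker, hD, map_sub, Algebra.trace_eq_of_algEquiv, sub_self]
  have hker : Module.finrank K D.ker ≤ 1 := by
    refine finrank_le_one ⟨1, by simp [hD]⟩ fun x => ?_
    obtain ⟨k, hk⟩ := hσ x (sub_eq_zero.1 x.2)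
    exact ⟨k, Subtype.ext (by rw [← hk, Algebra.algebraMap_eq_smul_one]; rfl)⟩
  have h1 := D.finrank_range_add_finrank_ker
  have h2 := (Algebra.trace K F).finrank_range_add_finrank_ker
  rw [LinearMap.range_eq_top.2 (Algebra.trace_surjective K F), finrank_top,
    Module.finrank_self] at h2
  -- The image of σ - 1 has codimension at most one and lies in the trace kernel, of codimension
  -- exactly one.
  have heq := Submodule.eq_of_le_of_finrank_le hle (by omega)
  exact heq.ge hy

end Trace

/-! ### Traces to the prime field -/

section CharTwo

theorem trace_sq {K : Type*} [Field K] [Finite K] [Algebra (ZMod 2) K] (x : K) :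
    Algebra.trace (ZMod 2) K (x ^ 2) = Algebra.trace (ZMod 2) K x := by
  have := Fintype.ofFinite K
  have h := Algebra.trace_eq_of_algEquiv
    (FiniteField.frobeniusAlgEquivOfAlgebraic (ZMod 2) K) x
  simpa [ZMod.card] using h

theorem zmod_two_eq_zero_of_ne_one {t : ZMod 2} (h : t ≠ 1) : t = 0 := by
  revert t; decide

/-- A cubic `η (ρ³ + b² ρ)` over a field of characteristic two larger than `𝔽₂` attains a value
of trace one. -/
theorem exists_trace_cubic_eq_one {K : Type*} [Field K] [Finite K] [Algebra (ZMod 2) K]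
    {c : K} (hc0 : c ≠ 0) (hc1 : c ≠ 1) {η b : K} (hη : η ≠ 0) (hb : b ≠ 0) :
    ∃ ρ, Algebra.trace (ZMod 2) K (η * (ρ ^ 3 + b ^ 2 * ρ)) = 1 := by
  have : CharP K 2 := charP_of_injective_algebraMap (algebraMap (ZMod 2) K).injective 2
  by_contra! hne
  have h0 : ∀ ρ, Algebra.trace (ZMod 2) K (η * (ρ ^ 3 + b ^ 2 * ρ)) = 0 := fun ρ =>
    zmod_two_eq_zero_of_ne_one (hne ρ)
  -- Polarising the cubic and squaring the term linear in l gives tr((η k + η² k⁴) l²) = 0 for all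
  -- l; squares exhaust K.
  have h1 : ∀ k, k ≠ 0 → η * k ^ 3 = 1 := by
    intro k hk
    have h2 : ∀ l, Algebra.trace (ZMod 2) K ((η * k + η ^ 2 * k ^ 4) * l ^ 2) = 0 := by
      intro l
      have e : η * ((k + l) ^ 3 + b ^ 2 * (k + l)) =
          η * (k ^ 3 + b ^ 2 * k) + η * (l ^ 3 + b ^ 2 * l) + (η * k ^ 2 * l + η * k * l ^ 2) := by
        grind
      have h3 := h0 (k + l)
      rw [e, map_add, map_add, h0, h0, zero_add, zero_add, map_add, ← trace_sq, ← map_add] at h3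
      rw [← h3]
      congr 1
      ring
    have h4 : η * k + η ^ 2 * k ^ 4 = 0 := by
      refine eq_zero_of_forall_trace_mul_eq_zero (K := ZMod 2) fun y => ?_
      obtain ⟨l, rfl⟩ := (FiniteField.isSquare_of_char_two (ringChar.eq K 2) y)
      rw [← sq]
      exact h2 l
    have h5 : η * k ≠ 0 := mul_ne_zero hη hk
    grind
  have hη1 : η = 1 := by simpa using h1 1 one_ne_zero
  subst hη1
  have h6 : ∀ k, k ≠ 0 → Algebra.trace (ZMod 2) K (b ^ 2 * k) = Algebra.trace (ZMod 2) K 1 := by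
    intro k hk
    have h7 := h0 k
    rw [mul_add, h1 k hk, one_mul, map_add] at h7
    exact (CharTwo.add_eq_zero.1 h7).symm
  -- The functional k ↦ tr(b² k) is constant on nonzero k; additivity on c, 1 and c + 1, all
  -- nonzero, makes that constant zero.
  have h8 : Algebra.trace (ZMod 2) K 1 = 0 := by
    have hc2 : c + 1 ≠ 0 := fun h => hc1 (CharTwo.add_eq_zero.1 h)
    have h9 := h6 (c + 1) hc2
    rw [mul_add, map_add, h6 c hc0, h6 1 one_ne_zero, CharTwo.add_self_eq_zero] at h9
    exact h9.symm
  refine hb (pow_eq_zero_iff two_ne_zero |>.1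
    (eq_zero_of_forall_trace_mul_eq_zero (K := ZMod 2) fun y => ?_))
  by_cases hy : y = 0
  · simp [hy]
  · rw [h6 y hy, h8]

end CharTwo

/-! ### Solving the trace conditions over K -/

section Automorphism

variable {K F : Type*} [Field K] [Field F] [Finite F] [Algebra (ZMod 2) K] [Algebra K F]

/-- Here 1, (z * σ z)⁻¹ and z + σ z are independent over K, so their traces against m can be
prescribed freely. -/
theorem exists_trace_conditions_of_norm_notMem (σ : F ≃ₐ[K] F)
    (hσ : ∀ x, σ (σ x) = x → ∃ k, algebraMap K F k = x) {z : F}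
    (hz : ¬ ∃ k, algebraMap K F k = z)
    (hM : ¬ ∃ k, algebraMap K F k = z * σ z * σ (σ z)) (δ : K) :
    ∃ m : F, Algebra.trace K F m = 1 ∧ Algebra.trace K F (m * (z * σ z)⁻¹) = δ ∧
      Algebra.trace (ZMod 2) K (Algebra.trace K F (m * (z + σ z))) = 1 := by
  have : CharP K 2 := charP_of_injective_algebraMap (algebraMap (ZMod 2) K).injective 2
  have : CharP F 2 := charP_of_injective_algebraMap (algebraMap K F).injective 2
  have : Finite K := Finite.of_injective _ (algebraMap K F).injective
  have hz0 : z ≠ 0 := fun h => hz ⟨0, by simp [h]⟩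
  have hz1 : σ z ≠ 0 := by simpa using hz0
  have hz2 : σ (σ z) ≠ 0 := by simpa using hz0
  have hli : LinearIndependent K ![1, (z * σ z)⁻¹, z + σ z] := by
    rw [Fintype.linearIndependent_iff]
    intro g hg
    rw [Fin.sum_univ_three] at hg
    simp only [Matrix.cons_val_zero, Matrix.cons_val_one, Matrix.cons_val, Algebra.smul_def,
      mul_one] at hg
    have h1 := congrArg σ hg
    simp only [map_add, map_mul, map_inv₀, AlgEquiv.commutes, map_zero] at h1
    have hne : z + σ (σ z) ≠ 0 := fun h => hz (hσ z (CharTwo.add_eq_zero.1 h).symm)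
    -- Adding the relation to its σ-conjugate eliminates `g 0`, and the factor z + σ² z cancels.
    have hYS : algebraMap K F (g 1) = algebraMap K F (g 2) * (z * σ z * σ (σ z)) := by
      refine mul_right_cancel₀ hne ?_
      field_simp at hg h1
      linear_combination σ (σ z) * hg + z * h1 - (algebraMap K F (g 0) * z * σ z * σ (σ z) +
        algebraMap K F (g 2) * z * σ z * σ (σ z) * (z + σ z + σ (σ z))) * CharTwo.two_eq_zero (R := F)
    have hS : g 2 = 0 := by
      by_contra hS
      have hS' : algebraMap K F (g 2) ≠ 0 := by simpa using hS
      exact hM ⟨g 1 / g 2, by rw [map_div₀, hYS]; field_simp⟩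
    have hY : g 1 = 0 := by simpa [hS] using hYS
    have hX : g 0 = 0 := by simpa [hS, hY] using hg
    intro j
    fin_cases j <;> assumption
  obtain ⟨s, hs⟩ := Algebra.trace_surjective (ZMod 2) K 1
  obtain ⟨m, hm⟩ := exists_trace_mul_eq hli ![1, δ, s]
  have h0 := hm 0
  have h1 := hm 1
  have h2 := hm 2
  simp only [Matrix.cons_val_zero, Matrix.cons_val_one, Matrix.cons_val, mul_one] at h0 h1 h2
  exact ⟨m, h0, h1, by rw [h2, hs]⟩

/-- Now z + σ z = e + M (z * σ z)⁻¹, so the third trace is determined by the first two. The freedom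
left is ρ = Tr(m (z * σ z)⁻¹); scaling z by l with l² = ρ/δ restores the value δ, and the last
condition becomes a cubic in ρ. The element c only witnesses K ≠ 𝔽₂. -/
theorem exists_trace_conditions_of_norm_mem (σ : F ≃ₐ[K] F)
    (hσ : ∀ x, σ (σ x) = x → ∃ k, algebraMap K F k = x) {c : K} (hc0 : c ≠ 0) (hc1 : c ≠ 1)
    {z : F} (hz : ¬ ∃ k, algebraMap K F k = z) {M e : K}
    (hM : algebraMap K F M = z * σ z * σ (σ z)) (he : algebraMap K F e = z + σ z + σ (σ z))
    (he0 : e ≠ 0) {δ : K} (hδ : δ ≠ 0) :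
    ∃ m z : F, z ≠ 0 ∧ Algebra.trace K F m = 1 ∧ Algebra.trace K F (m * (z * σ z)⁻¹) = δ ∧
      Algebra.trace (ZMod 2) K (Algebra.trace K F (m * (z + σ z))) = 1 := by
  have : CharP K 2 := charP_of_injective_algebraMap (algebraMap (ZMod 2) K).injective 2
  have : CharP F 2 := charP_of_injective_algebraMap (algebraMap K F).injective 2
  have : Finite K := Finite.of_injective _ (algebraMap K F).injective
  have hz0 : z ≠ 0 := fun h => hz ⟨0, by simp [h]⟩
  have hz1 : σ z ≠ 0 := by simpa using hz0
  have hz2 : σ (σ z) ≠ 0 := by simpa using hz0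
  have hM0 : M ≠ 0 := by
    rintro rfl
    rw [map_zero] at hM
    exact mul_ne_zero (mul_ne_zero hz0 hz1) hz2 hM.symm
  have hli : LinearIndependent K ![1, (z * σ z)⁻¹] := by
    rw [LinearIndependent.pair_iff]
    intro x y h
    have hy : y = 0 := by
      by_contra hy
      refine hz (hσ z ?_)
      have h1 := congrArg σ h
      simp only [Algebra.smul_def, map_add, map_mul, map_inv₀, AlgEquiv.commutes, map_one,
        map_zero] at h h1
      have hy' : algebraMap K F y ≠ 0 := by simpa using hy
      have h2 := inv_injective (mul_left_cancel₀ hy' (add_left_cancel (h.trans h1.symm)))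
      exact mul_left_cancel₀ hz1 (by rw [← h2, mul_comm])
    subst hy
    simpa using h
  -- These constants come from squaring l (e + M ρ): the result is (ρ/δ)(e + M ρ)² = (M²/δ)(ρ³ +
  -- (e/M)² ρ).
  obtain ⟨ρ, hρ⟩ := exists_trace_cubic_eq_one hc0 hc1 (η := M ^ 2 / δ) (b := e / M)
    (by positivity) (by positivity)
  have hρ0 : ρ ≠ 0 := by
    rintro rfl
    simp at hρ
  obtain ⟨m, hm⟩ := exists_trace_mul_eq hli ![1, ρ]
  have h0 := hm 0
  have h1 := hm 1
  simp only [Matrix.cons_val_zero, Matrix.cons_val_one, mul_one] at h0 h1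
  obtain ⟨l, hl⟩ := FiniteField.isSquare_of_char_two (ringChar.eq K 2) (ρ / δ)
  have hl0 : l ≠ 0 := by
    rintro rfl
    grind
  have hl0' : algebraMap K F l ≠ 0 := by simpa using hl0
  refine ⟨m, algebraMap K F l * z, mul_ne_zero hl0' hz0, h0, ?_, ?_⟩
  · have e1 : m * (algebraMap K F l * z * σ (algebraMap K F l * z))⁻¹ =
        (l * l)⁻¹ • (m * (z * σ z)⁻¹) := by
      rw [Algebra.smul_def, map_mul, AlgEquiv.commutes, map_inv₀, map_mul]
      field_simp
    rw [e1, map_smul, h1, ← hl, smul_eq_mul]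
    field_simp
  · have hτ : Algebra.trace K F
        (m * (algebraMap K F l * z + σ (algebraMap K F l * z))) = l * (e + M * ρ) := by
      rw [show m * (algebraMap K F l * z + σ (algebraMap K F l * z)) =
        l • (e • m + M • (m * (z * σ z)⁻¹)) by
          simp only [Algebra.smul_def, map_mul, AlgEquiv.commutes, hM, he]
          field_simp
          grind,
        map_smul, map_add, map_smul, map_smul, h0, h1, smul_eq_mul, smul_eq_mul, smul_eq_mul,
        mul_one]
    rw [hτ, ← trace_sq, ← hρ]
    congr 1
    have e3 : (l * (e + M * ρ)) ^ 2 = (ρ / δ) * (e + M * ρ) ^ 2 := by rw [hl]; ring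
    rw [e3, CharTwo.add_sq]
    field_simp
    ring

theorem exists_trace_conditions (σ : F ≃ₐ[K] F)
    (hσ : ∀ x, σ (σ x) = x → ∃ k, algebraMap K F k = x) {c : K} (hc0 : c ≠ 0) (hc1 : c ≠ 1)
    (hK : ¬ Function.Surjective (algebraMap K F)) {δ : K} (hδ : δ ≠ 0) :
    ∃ m z : F, z ≠ 0 ∧ Algebra.trace K F m = 1 ∧ Algebra.trace K F (m * (z * σ z)⁻¹) = δ ∧
      Algebra.trace (ZMod 2) K (Algebra.trace K F (m * (z + σ z))) = 1 := by
  have : CharP K 2 := charP_of_injective_algebraMap (algebraMap (ZMod 2) K).injective 2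
  have : CharP F 2 := charP_of_injective_algebraMap (algebraMap K F).injective 2
  have hfix : ∀ x, σ x = x → ∃ k, algebraMap K F k = x := fun x hx => hσ x (by rw [hx, hx])
  have key : ∀ z : F, (¬ ∃ k, algebraMap K F k = z) → z + σ z + σ (σ z) ≠ 0 →
      ∃ m z : F, z ≠ 0 ∧ Algebra.trace K F m = 1 ∧ Algebra.trace K F (m * (z * σ z)⁻¹) = δ ∧
      Algebra.trace (ZMod 2) K (Algebra.trace K F (m * (z + σ z))) = 1 := by
    intro z hz he
    have hz0 : z ≠ 0 := fun h => hz ⟨0, by simp [h]⟩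
    have hz1 : σ z ≠ 0 := by simpa using hz0
    have hz2 : σ (σ z) ≠ 0 := by simpa using hz0
    by_cases hM : ∃ k, algebraMap K F k = z * σ z * σ (σ z)
    · obtain ⟨M, hM⟩ := hM
      have h3 : σ (σ (σ z)) = z := by
        have h := congrArg σ hM
        rw [AlgEquiv.commutes, hM] at h
        simp only [map_mul] at h
        refine mul_left_cancel₀ (mul_ne_zero hz1 hz2) ?_
        rw [← h]; ring
      obtain ⟨e, he'⟩ := hfix (z + σ z + σ (σ z)) (by simp only [map_add, h3]; ring)
      refine exists_trace_conditions_of_norm_mem σ hσ hc0 hc1 hz hM he' ?_ hδ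
      rintro rfl
      exact he (by rw [← he', map_zero])
    · obtain ⟨m, hm⟩ := exists_trace_conditions_of_norm_notMem σ hσ hz hM δ
      exact ⟨m, z, hz0, hm⟩
  obtain ⟨z, hz⟩ := not_forall.1 hK
  by_cases he : z + σ z + σ (σ z) = 0
  · refine key (z + 1) ?_ ?_
    · rintro ⟨k, hk⟩
      exact hz ⟨k - 1, by rw [map_sub, hk, map_one]; ring⟩
    · simp only [map_add, map_one]
      grind
  · exact key z hz he

/-- The equation is that of two solutions of `h (u) + h (v) = δ⁻¹ (σ a + a + 1)`, where
`h x = x * σ x`, which are separated by the linear form `y ↦ Tr (σ a * y + a * σ y)`. -/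
theorem exists_separated_solutions [Algebra (ZMod 2) F] (σ : F ≃ₐ[K] F)
    (hσ : ∀ x, σ (σ x) = x → ∃ k, algebraMap K F k = x) {c : K} (hc0 : c ≠ 0) (hc1 : c ≠ 1)
    (hK : ¬ Function.Surjective (algebraMap K F)) (hone : Algebra.trace K F 1 = 1)
    {δ : K} (hδ : δ ≠ 0) :
    ∃ a u v : F, algebraMap K F δ * (u * σ u + v * σ v) = σ a + a + 1 ∧
      Algebra.trace (ZMod 2) F (σ a * u + a * σ u) + 1 =
        Algebra.trace (ZMod 2) F (σ a * v + a * σ v) := by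
  have : CharP K 2 := charP_of_injective_algebraMap (algebraMap (ZMod 2) K).injective 2
  have : CharP F 2 := charP_of_injective_algebraMap (algebraMap K F).injective 2
  have : Finite K := Finite.of_injective _ (algebraMap K F).injective
  have : Module.Finite K F := Module.Finite.of_finite
  have : IsScalarTower (ZMod 2) K F := IsScalarTower.of_algebraMap_eq' (Subsingleton.elim _ _)
  have hfix : ∀ x, σ x = x → ∃ k, algebraMap K F k = x := fun x hx => hσ x (by rw [hx, hx])
  obtain ⟨m, z, hz, h1, h2, h3⟩ := exists_trace_conditions σ hσ hc0 hc1 hK hδ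
  have hz1 : σ z ≠ 0 := by simpa using hz
  have hδ' : algebraMap K F δ ≠ 0 := by simpa using hδ
  obtain ⟨a, ha⟩ := exists_sub_eq_of_trace_eq_zero σ hfix (y := m + 1)
    (by rw [map_add, h1, hone, CharTwo.add_self_eq_zero])
  obtain ⟨t, ht⟩ := exists_sub_eq_of_trace_eq_zero σ hfix
    (y := δ⁻¹ • (m * (z * σ z)⁻¹) + 1)
    (by rw [map_add, map_smul, h2, hone, smul_eq_mul, inv_mul_cancel₀ hδ,
      CharTwo.add_self_eq_zero])
  rw [Algebra.smul_def, map_inv₀] at ht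
  rw [Algebra.trace_trace] at h3
  -- With h x = x * σ x, h(z t) + h(z t + z) = h(z)(t + σ t + 1), and t was chosen to make this δ⁻¹
  -- m.
  refine ⟨a, z * t, z * t + z, ?_, ?_⟩
  · have hm : m = σ a + a + 1 := by grind
    rw [← hm]
    simp only [map_add, map_mul]
    have ht' : σ t = t + 1 + (algebraMap K F δ)⁻¹ * (m * (z * σ z)⁻¹) := by grind
    rw [ht']
    field_simp
    grind
  · have hinv : ∀ x, Algebra.trace (ZMod 2) F (σ x) = Algebra.trace (ZMod 2) F x := fun x =>
      Algebra.trace_eq_of_algEquiv (σ.restrictScalars (ZMod 2)) x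
    -- The last two brackets have the form σ y + y, hence absolute trace zero.
    have e : m * (z + σ z) = (σ a * z + a * σ z) + (σ (a * z) + a * z) + (σ z + z) := by
      rw [map_mul]; grind
    rw [e, map_add, map_add, map_add _ (σ (a * z)), map_add _ (σ z), hinv, hinv,
      CharTwo.add_self_eq_zero, CharTwo.add_self_eq_zero, add_zero, add_zero] at h3
    rw [← h3, ← map_add, map_add σ]
    congr 1
    ring

end Automorphism

/-! ### The c-derivative of G -/

section Galpha

variable {F : Type*} [Field F] [Algebra (ZMod 2) F]

/-- The quadratic Boolean function `x ↦ Tr (α x + x ^ (2 ^ i + 1))`. -/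
noncomputable def traceQuad (i : ℕ) (α x : F) : ZMod 2 :=
  Algebra.trace (ZMod 2) F (α * x + x ^ (2 ^ i + 1))

/-- The map `x ↦ x + Tr (α x + x ^ (2 ^ i + 1))`. -/
noncomputable def traceShift (i : ℕ) (α x : F) : F :=
  x + algebraMap (ZMod 2) F (traceQuad i α x)

theorem Galpha_eq (i : ℕ) (α x : F) : Galpha i α x = traceShift i α x ^ (2 ^ i + 1) := rfl

theorem trace_pow_two_pow [Finite F] (i : ℕ) (x : F) :
    Algebra.trace (ZMod 2) F (x ^ 2 ^ i) = Algebra.trace (ZMod 2) F x := by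
  induction i with
  | zero => simp
  | succ i ih => rw [pow_succ, pow_mul, trace_sq, ih]

theorem traceQuad_add (i : ℕ) (α x y : F) :
    traceQuad i α (x + y) = traceQuad i α x + traceQuad i α y +
      Algebra.trace (ZMod 2) F (x ^ 2 ^ i * y + x * y ^ 2 ^ i) := by
  have : CharP F 2 := charP_of_injective_algebraMap (algebraMap (ZMod 2) F).injective 2
  simp only [traceQuad, ← map_add]
  congr 1
  rw [pow_succ (x + y), add_pow_char_pow]
  ring

/-- The hypothesis says Q(1) = 0, and the polar form of Q at (x, 1) is Tr(σ x + x) = 0. -/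
theorem traceQuad_add_algebraMap [Finite F] {i : ℕ} {α : F}
    (hα : Algebra.trace (ZMod 2) F (α + 1) = 0) (x : F) (t : ZMod 2) :
    traceQuad i α (x + algebraMap (ZMod 2) F t) = traceQuad i α x := by
  obtain rfl | rfl : t = 0 ∨ t = 1 := by revert t; decide
  · simp
  · rw [map_one, traceQuad_add, one_pow, mul_one, mul_one, map_add _ (x ^ 2 ^ i),
      trace_pow_two_pow, CharTwo.add_self_eq_zero, add_zero]
    have h : traceQuad i α 1 = 0 := by simpa [traceQuad] using hα
    rw [h, add_zero]

theorem traceShift_traceShift [Finite F] {i : ℕ} {α : F}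
    (hα : Algebra.trace (ZMod 2) F (α + 1) = 0) (x : F) :
    traceShift i α (traceShift i α x) = x := by
  have : CharP F 2 := charP_of_injective_algebraMap (algebraMap (ZMod 2) F).injective 2
  rw [traceShift, traceShift, traceQuad_add_algebraMap hα, add_assoc, CharTwo.add_self_eq_zero,
    add_zero]

theorem traceShift_add (i : ℕ) (α x a : F) :
    traceShift i α (x + a) = traceShift i α x +
      (a + algebraMap (ZMod 2) F (traceQuad i α x + traceQuad i α (x + a))) := by
  have : CharP F 2 := charP_of_injective_algebraMap (algebraMap (ZMod 2) F).injective 2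
  simp only [traceShift, map_add]
  grind

theorem cDerivative_Galpha (i : ℕ) (α c a x : F) :
    cDerivative (Galpha i α) c a x = cDerivative (· ^ (2 ^ i + 1)) c
      (a + algebraMap (ZMod 2) F (traceQuad i α x + traceQuad i α (x + a)))
      (traceShift i α x) := by
  simp only [cDerivative, Galpha_eq, traceShift_add]

/-- Completing the square in the c-derivative of the power map `x ^ (2 ^ i + 1)`. -/
theorem cDerivative_pow {i : ℕ} {c : F} (hc : c ^ 2 ^ i = c) (hc1 : 1 + c ≠ 0) (a x : F) :
    cDerivative (· ^ (2 ^ i + 1)) c a x =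
      (1 + c) * (x + a / (1 + c)) ^ (2 ^ i + 1) + c / (1 + c) * a ^ (2 ^ i + 1) := by
  have : CharP F 2 := charP_of_injective_algebraMap (algebraMap (ZMod 2) F).injective 2
  simp only [cDerivative, pow_succ _ (2 ^ i), add_pow_char_pow, div_pow, hc, one_pow]
  field_simp
  grind

/-- The bit Q(x) + Q(x + a) is injective on solutions: once it is fixed, the completed square and
injectivity of the power map determine x. -/
theorem cDiffCount_Galpha_le [Finite F] {i : ℕ} {α : F} (hα : Algebra.trace (ZMod 2) F (α + 1) = 0)
    (hinj : Function.Injective fun x : F => x ^ (2 ^ i + 1)) {c : F} (hc : c ^ 2 ^ i = c)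
    (hc1 : 1 + c ≠ 0) (a b : F) : cDiffCount (Galpha i α) c a b ≤ 2 := by
  have h := Set.ncard_le_ncard_of_injOn (s := {x : F | cDerivative (Galpha i α) c a x = b})
    (t := (Set.univ : Set (ZMod 2))) (fun x => traceQuad i α x + traceQuad i α (x + a))
    (fun _ _ => Set.mem_univ _) (fun x hx y hy hxy => by
      simp only [Set.mem_ofPred_eq, cDerivative_Galpha] at hx hy hxy
      rw [hxy, ← hy, cDerivative_pow hc hc1, cDerivative_pow hc hc1, add_left_inj] at hx
      have h := add_right_cancel (hinj (mul_left_cancel₀ hc1 hx))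
      rw [← traceShift_traceShift hα x, h, traceShift_traceShift hα])
  simpa [cDiffCount, Set.ncard_univ] using h

theorem traceQuad_add_traceQuad_add (i : ℕ) (α c a u : F) (hc : c ^ 2 ^ i = c) :
    traceQuad i α (u + a / (1 + c)) + traceQuad i α (u + a / (1 + c) + a) =
      traceQuad i α a + Algebra.trace (ZMod 2) F (a ^ 2 ^ i * u + a * u ^ 2 ^ i) := by
  have : CharP F 2 := charP_of_injective_algebraMap (algebraMap (ZMod 2) F).injective 2
  rw [traceQuad_add _ _ _ a, add_assoc (traceQuad i α (u + a / (1 + c))), ← add_assoc,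
    CharTwo.add_self_eq_zero, zero_add]
  congr 2
  simp only [add_pow_char_pow, div_pow, hc, one_pow]
  grind

/-- The solutions are T(u + a/(1 + c)), with bit 0, and T(v + (a + 1)/(1 + c)), with bit 1; `huv`
says that their c-derivatives agree. -/
theorem two_le_cDiffCount_Galpha [Finite F] {i : ℕ} {α : F} (hα : Algebra.trace (ZMod 2) F (α + 1) = 0)
    {c : F} (hc : c ^ 2 ^ i = c) (hc0 : c ≠ 0) (hc1 : 1 + c ≠ 0) {a u v : F}
    (huv : (1 + c) ^ 2 / c * (u ^ (2 ^ i + 1) + v ^ (2 ^ i + 1)) = a ^ 2 ^ i + a + 1)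
    (hu : traceQuad i α a + Algebra.trace (ZMod 2) F (a ^ 2 ^ i * u + a * u ^ 2 ^ i) = 0)
    (hv : traceQuad i α a + Algebra.trace (ZMod 2) F (a ^ 2 ^ i * v + a * v ^ 2 ^ i) = 1) :
    ∃ b, 2 ≤ cDiffCount (Galpha i α) c a b := by
  have : CharP F 2 := charP_of_injective_algebraMap (algebraMap (ZMod 2) F).injective 2
  have hγ : Algebra.trace (ZMod 2) F (a ^ 2 ^ i * (1 / (1 + c)) + a * (1 / (1 + c)) ^ 2 ^ i) =
      0 := by
    have e : a ^ 2 ^ i * (1 / (1 + c)) + a * (1 / (1 + c)) ^ 2 ^ i =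
        (a / (1 + c)) ^ 2 ^ i + a / (1 + c) := by
      simp only [div_pow, add_pow_char_pow, hc, one_pow]
      ring
    rw [e, map_add, trace_pow_two_pow, CharTwo.add_self_eq_zero]
  have key : ∀ w, traceQuad i α (traceShift i α (w + a / (1 + c))) +
      traceQuad i α (traceShift i α (w + a / (1 + c)) + a) =
      traceQuad i α a + Algebra.trace (ZMod 2) F (a ^ 2 ^ i * w + a * w ^ 2 ^ i) := by
    intro w
    rw [← traceQuad_add_traceQuad_add i α c a w hc, traceShift, add_right_comm _ _ a,
      traceQuad_add_algebraMap hα, traceQuad_add_algebraMap hα]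
  -- For bit 1 the centre of the square moves by 1/(1 + c); by `hγ` this does not affect the bit.
  have hv' : traceQuad i α a + Algebra.trace (ZMod 2) F
      (a ^ 2 ^ i * (v + 1 / (1 + c)) + a * (v + 1 / (1 + c)) ^ 2 ^ i) = 1 := by
    rw [← hv, add_pow_char_pow, mul_add, mul_add, add_add_add_comm, map_add _ (_ + _), hγ,
      add_zero]
  set x := traceShift i α (u + a / (1 + c)) with hx
  set y := traceShift i α (v + 1 / (1 + c) + a / (1 + c)) with hy
  have hkx := (key u).trans hu
  have hky := (key _).trans hv'
  rw [← hx] at hkx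
  rw [← hy] at hky
  have hxy : x ≠ y := by
    intro h
    rw [h, hky] at hkx
    exact one_ne_zero hkx
  have heq : cDerivative (Galpha i α) c a x = cDerivative (Galpha i α) c a y := by
    rw [cDerivative_Galpha, cDerivative_Galpha, hkx, hky, hx, hy, traceShift_traceShift hα,
      traceShift_traceShift hα, cDerivative_pow hc hc1, cDerivative_pow hc hc1, map_zero, map_one,
      add_zero]
    have e1 : u + a / (1 + c) + a / (1 + c) = u := by grind
    have e2 : v + 1 / (1 + c) + a / (1 + c) + (a + 1) / (1 + c) = v := by grind
    have e3 : (a + 1) ^ (2 ^ i + 1) = a ^ (2 ^ i + 1) + (a ^ 2 ^ i + a + 1) := by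
      rw [pow_succ, add_pow_char_pow, one_pow]; ring
    rw [e1, e2, e3, ← huv]
    field_simp
    grind
  refine ⟨cDerivative (Galpha i α) c a y, ?_⟩
  rw [cDiffCount, ← Set.ncard_pair hxy]
  refine Set.ncard_le_ncard ?_ (Set.toFinite _)
  rintro w (rfl | rfl)
  · exact heq
  · rfl

end Galpha

/-! ### Fixed fields and injectivity of the power map -/

section FiniteFieldFacts

variable {F : Type*} [Field F]

/-- Otherwise X^q - X, with q the order of K, would have q + 1 roots. -/
theorem Subfield.mem_of_pow_card_eq [Finite F] (K : Subfield F) {x : F} (hx : x ^ Nat.card K = x) :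
    x ∈ K := by
  classical
  have := Fintype.ofFinite F
  by_contra hxK
  have hcard : 1 < Nat.card K := Finite.one_lt_card
  have hp := FiniteField.X_pow_card_sub_X_ne_zero F hcard
  have hsub : (insert x (Finset.univ.filter (· ∈ K))).val ⊆
      (Polynomial.X ^ Nat.card K - Polynomial.X : Polynomial F).roots := by
    intro y hy
    rw [Polynomial.mem_roots hp, Polynomial.IsRoot, Polynomial.eval_sub, Polynomial.eval_pow,
      Polynomial.eval_X, sub_eq_zero]
    rw [Finset.mem_val, Finset.mem_insert, Finset.mem_filter] at hy
    rcases hy with rfl | ⟨-, hy⟩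
    · exact hx
    · rw [Nat.card_eq_fintype_card]
      exact congrArg Subtype.val (FiniteField.pow_card (⟨y, hy⟩ : K))
  have h := Polynomial.card_le_degree_of_subset_roots hsub
  rw [FiniteField.X_pow_card_sub_X_natDegree_eq F hcard, Finset.card_insert_of_notMem (by simpa),
    ← Fintype.card_subtype, ← Nat.card_eq_fintype_card] at h
  exact Nat.not_succ_le_self _ h

theorem pow_two_pow_gcd {x : F} {m n : ℕ} (hm : x ^ 2 ^ m = x) (hn : x ^ 2 ^ n = x) :
    x ^ 2 ^ Nat.gcd m n = x := by
  have h : ∀ k, Function.IsPeriodicPt (fun y : F => y ^ 2) k x ↔ x ^ 2 ^ k = x := fun k => by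
    rw [Function.IsPeriodicPt, Function.IsFixedPt, pow_iterate]
  exact (h _).1 (((h m).2 hm).gcd ((h n).2 hn))

/-- If x and y ≠ 0 have equal images, s = x/y satisfies σ s = s⁻¹, so σ² s = s; then σ s = s by `h`,
whence s² = 1 and s = 1. -/
theorem injective_pow_two_pow_add_one {i : ℕ} [CharP F 2]
    (h : ∀ x : F, (x ^ 2 ^ i) ^ 2 ^ i = x → x ^ 2 ^ i = x) :
    Function.Injective fun x : F => x ^ (2 ^ i + 1) := by
  intro x y hxy
  simp only at hxy
  by_cases hy : y = 0
  · subst hy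
    rw [zero_pow (Nat.succ_ne_zero _)] at hxy
    exact eq_zero_of_pow_eq_zero hxy
  have hs : (x / y) ^ 2 ^ i * (x / y) = 1 := by
    rw [← pow_succ, div_pow, hxy, div_self (pow_ne_zero _ hy)]
  have hinv : (x / y) ^ 2 ^ i = (x / y)⁻¹ := eq_inv_of_mul_eq_one_left hs
  have hfix := h (x / y) (by rw [hinv, inv_pow, hinv, inv_inv])
  rw [hfix, ← sq, ← one_pow 2, CharTwo.sq_inj] at hs
  exact (div_eq_one_iff_eq hy).1 hs

end FiniteFieldFacts

/-! ### Assembling the two bounds -/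

theorem IsAPcN.of_cDiffCount {F : Type*} [Field F] [Fintype F] {f : F → F} {c : F} (hc : c ≠ 1)
    (hle : ∀ a b, cDiffCount f c a b ≤ 2) (hge : ∃ a b, 2 ≤ cDiffCount f c a b) :
    IsAPcN f c := by
  obtain ⟨a, b, hab⟩ := hge
  refine le_antisymm (Finset.sup_le fun p _ => hle _ _) (hab.trans ?_)
  exact Finset.le_sup (f := fun p : F × F => cDiffCount f c p.1 p.2) (b := (a, b))
    (by simp [hc])

theorem exists_two_le_cDiffCount_Galpha {F : Type*} [Field F] [Finite F] [Algebra (ZMod 2) F]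
    {i : ℕ} {α : F} (hα : Algebra.trace (ZMod 2) F (α + 1) = 0) {K : Subfield F}
    (hKi : ∀ k : K, k ^ 2 ^ i = k) (hK : ∀ x : F, (x ^ 2 ^ i) ^ 2 ^ i = x → x ∈ K)
    (hKtop : K ≠ ⊤) (hodd : Odd (Module.finrank K F)) {c : K} (hc0 : c ≠ 0) (hc1 : c ≠ 1) :
    ∃ a b, 2 ≤ cDiffCount (Galpha i α) (c : F) a b := by
  have : CharP F 2 := charP_of_injective_algebraMap (algebraMap (ZMod 2) F).injective 2
  have : CharP K 2 := (algebraMap K F).charP (algebraMap K F).injective 2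
  let _ : Algebra (ZMod 2) K := ZMod.algebra K 2
  let σ : F ≃ₐ[K] F := AlgEquiv.ofRingEquiv (f := iterateFrobeniusEquiv F 2 i) fun k => by
    rw [iterateFrobeniusEquiv_apply, iterateFrobenius_def, ← map_pow, hKi]
  have hσ : ∀ x, σ x = x ^ 2 ^ i := fun x => rfl
  have hone : Algebra.trace K F 1 = 1 := by
    rw [← map_one (algebraMap K F), Algebra.trace_algebraMap, nsmul_one,
      CharTwo.natCast_eq_ite, if_neg (Nat.not_even_iff_odd.2 hodd)]
  have hc1' : 1 + c ≠ 0 := fun h => hc1 (CharTwo.add_eq_zero.1 h).symm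
  have hc0F : (c : F) ≠ 0 := by simpa using hc0
  have hc1F : 1 + (c : F) ≠ 0 := fun h => hc1' (Subtype.ext (by simpa using h))
  have hcF : (c : F) ^ 2 ^ i = c := congrArg Subtype.val (hKi c)
  obtain ⟨a, u, v, huv, hsep⟩ := exists_separated_solutions σ
    (fun x hx => ⟨⟨x, hK x hx⟩, rfl⟩) hc0 hc1
    (fun h => hKtop (eq_top_iff.2 fun x _ => by obtain ⟨k, rfl⟩ := h x; exact k.2)) hone
    (δ := (1 + c) ^ 2 / c) (div_ne_zero (pow_ne_zero 2 hc1') hc0)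
  have hδ : algebraMap K F ((1 + c) ^ 2 / c) = (1 + (c : F)) ^ 2 / c := by
    simp only [map_div₀, map_pow, map_add, map_one]; rfl
  simp only [hσ, hδ, ← pow_succ'] at huv hsep
  refine ⟨a, ?_⟩
  -- The equation `huv` is symmetric in u and v, so whichever of them has bit 0 takes the first
  -- role.
  by_cases h : traceQuad i α a + Algebra.trace (ZMod 2) F (a ^ 2 ^ i * u + a * u ^ 2 ^ i) = 0
  · refine two_le_cDiffCount_Galpha hα hcF hc0F hc1F huv h ?_
    rw [← hsep, ← add_assoc, h, zero_add]
  · have h1 : traceQuad i α a + Algebra.trace (ZMod 2) F (a ^ 2 ^ i * u + a * u ^ 2 ^ i) = 1 := by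
      by_contra h1
      exact h (zmod_two_eq_zero_of_ne_one h1)
    refine two_le_cDiffCount_Galpha hα hcF hc0F hc1F (by rw [add_comm (_ ^ _), huv]) ?_ h1
    rw [← hsep, ← add_assoc, h1, CharTwo.add_self_eq_zero]

theorem theorem5 {F : Type*} [Field F] [Fintype F] [Algebra (ZMod 2) F]
    (n i d : ℕ) (hF : Fintype.card F = 2 ^ n)
    (hd2 : d = Nat.gcd (2 * i) n) (hd : d = Nat.gcd i n) (hdn : d < n)
    (α : F) (hα : Algebra.trace (ZMod 2) F (α + 1) = 0)
    (K : Subfield F) (hK : Nat.card K = 2 ^ d) :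
    Function.Bijective (Galpha i α) ∧
      ∀ c : F, c ∈ K → c ∉ (⊥ : Subfield F) → IsAPcN (Galpha i α) c := by
  have : CharP F 2 := charP_of_injective_algebraMap (algebraMap (ZMod 2) F).injective 2
  have hKi : ∀ k : K, k ^ 2 ^ i = k := by
    have := Fintype.ofFinite K
    intro k
    obtain ⟨j, hj⟩ : d ∣ i := hd ▸ Nat.gcd_dvd_left i n
    rw [hj, pow_mul, ← hK, Nat.card_eq_fintype_card, FiniteField.pow_card_pow]
  have hmem : ∀ x : F, (x ^ 2 ^ i) ^ 2 ^ i = x → x ∈ K := by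
    intro x hx
    refine K.mem_of_pow_card_eq ?_
    rw [hK, hd2]
    refine pow_two_pow_gcd ?_ (by rw [← hF, FiniteField.pow_card])
    rwa [two_mul, pow_add, pow_mul]
  have hinj : Function.Injective fun x : F => x ^ (2 ^ i + 1) :=
    injective_pow_two_pow_add_one fun x hx => congrArg Subtype.val (hKi ⟨x, hmem x hx⟩)
  refine ⟨Finite.injective_iff_bijective.1 (hinj.comp
    (Function.LeftInverse.injective (traceShift_traceShift hα))), fun c hcK hc => ?_⟩
  have hc0 : c ≠ 0 := fun h => hc (h ▸ zero_mem _)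
  have hc1 : c ≠ 1 := fun h => hc (h ▸ one_mem _)
  have hrank : n = d * Module.finrank K F := by
    have := Fintype.ofFinite K
    have h := Module.card_eq_pow_finrank (K := K) (V := F)
    rw [hF, ← Nat.card_eq_fintype_card, hK, ← pow_mul] at h
    exact Nat.pow_right_injective le_rfl h
  have hodd : Odd (Module.finrank K F) := by
    by_contra h
    obtain ⟨r, hr⟩ := Nat.not_odd_iff_even.1 h
    -- If n/d were even, 2d would divide both 2i and n, hence their gcd d.
    have hdvd : d * 2 ∣ d := by
      conv_rhs => rw [hd2]
      refine Nat.dvd_gcd ?_ ⟨r, by rw [mul_assoc, two_mul, ← hr, ← hrank]⟩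
      rw [mul_comm]
      exact Nat.mul_dvd_mul_left 2 (hd ▸ Nat.gcd_dvd_left i n)
    have hd0 : d ≠ 0 := by
      rintro rfl
      omega
    have := Nat.le_of_dvd (Nat.pos_of_ne_zero hd0) hdvd
    omega
  have hKtop : K ≠ ⊤ := by
    rintro rfl
    rw [Nat.card_congr (Subfield.topEquiv (K := F)).toEquiv, Nat.card_eq_fintype_card, hF] at hK
    exact hdn.ne (Nat.pow_right_injective le_rfl hK).symm
  refine IsAPcN.of_cDiffCount hc1
    (cDiffCount_Galpha_le hα hinj (congrArg Subtype.val (hKi ⟨c, hcK⟩))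
      fun h => hc1 (CharTwo.add_eq_zero.1 h).symm)
    (exists_two_le_cDiffCount_Galpha hα hKi hmem hKtop hodd (c := ⟨c, hcK⟩) ?_ ?_)
  · exact fun h => hc0 (congrArg Subtype.val h)
  · exact fun h => hc1 (congrArg Subtype.val h)
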